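/- Let $n\ge 1$ and let $\mathbb H^n=\mathbb C^n\times\mathbb R$ be the Heisenberg group with group law $(z,t)(w,s)=\bigl(z+w,\ t+s+\tfrac12\operatorname{Im}(z\cdot\overline w)\bigr)$ and Haar measure $dz\,dt$ (Lebesgue measure). Let $L^{n-1}_k$ denote the Laguerre polynomial of degree $k$ and type $n-1$, and put $\varphi^{n-1}_{k,\lambda}(z)=L^{n-1}_k(\tfrac12|\lambda||z|^2)e^{-\frac14|\lambda||z|^2}$ for $\lambda\ne0$ and $c_{n,k}=\frac{k!\,(n-1)!}{(k+n-1)!}$. The Heisenberg fan $\Omega\subset\mathbb R^2$ is the union of the rays $R_k=\{(\lambda,(2k+n)|\lambda|):\lambda\in\mathbb R\setminus\{0\}\}$, $k=0,1,2,\dots$, and of $R_\infty=\{(0,\tau):\tau\ge0\}$. It carries the measure $\nu_2$ given by $$\int_\Omega\phi\,d\nu_2=(2\pi)^{-2n-1}\int_{-\infty}^\infty\sum_{k=0}^\infty c_{n,k}^{-2}\,\phi(\lambda,(2k+n)|\lambda|)\,|\lambda|^{2n}\,d\lambda .$$ For $a=(\lambda,(2k+n)|\lambda|)\in R_k$ let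 $e_a(z,t)=e^{i\lambda t}\varphi^{n-1}_{k,\lambda}(z)$. The normalized Strichartz Fourier transform of $f\in L^1\cap L^2(\mathbb H^n)$ is the function on $\Omega\times\mathbb C^n$ given by $$\mathcal F(f)(a,w)=c_{n,k}\int_{\mathbb H^n}f(z,t)\,e_a\bigl((z,t)^{-1}(w,0)\bigr)\,dz\,dt,\qquad a\in R_k,$$ $$\mathcal F(f)((0,\tau),w)=2^{n-1}(n-1)!\int_{\mathbb H^n}f(z,t)\,\frac{J_{n-1}(\sqrt\tau|w-z|)}{(\sqrt\tau|w-z|)^{n-1}}\,dz\,dt,\qquad (0,\tau)\in R_\infty,$$ where $J_{n-1}$ is the Bessel function and the quotient $J_{n-1}(x)/x^{n-1}$ is extended continuously to $x=0$. **Theorem (Benedicks' theorem for the Strichartz Fourier transform).** Let $V\subseteq\mathbb H^n$ and $W\subseteq\Omega$ be measurable sets of finite measure (with respect to $dz\,dt$ and $\nu_2$ respectively), and assume that $$W\subseteq\{(\lambda,(2k+n)|\lambda|):|\lambda|>M,\ k\in\mathbb N\cup\{0\}\}$$ for some $M>0$. Let $f\in L^2(\mathbb H^n)$ vanish almost everywhere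 outside $V$ (so that $f\in L^1(\mathbb H^n)$ as well), and suppose that, for some measurable $B\subseteq\mathbb C^n$, $\mathcal F(f)$ vanishes $(\nu_2\otimes dw)$-almost everywhere outside $W\times B$. Then $f=0$ almost everywhere. -/

import Mathlib

open MeasureTheory
open scoped ENNReal Nat

noncomputable section

namespace Strichartz

/-- The space `ℂⁿ`; its `volume` is Lebesgue measure `dz = dx dy`. -/
abbrev Cn (n : ℕ) : Type := Fin n → ℂ

/-- The Euclidean norm on `ℂⁿ` (the norm instance on `Fin n → ℂ` is the sup norm, and is not used). -/
def enorm2 {n : ℕ} (z : Cn n) : ℝ := Real.sqrt (∑ j, ‖z j‖ ^ 2)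

/-- The underlying measure space `ℂⁿ × ℝ` of the Heisenberg group; `volume` is its Haar measure
`dz dt`. The group law is `mul` (not the componentwise product of the product type). -/
abbrev Heis (n : ℕ) : Type := Cn n × ℝ

/-- `(z,t)(w,s) = (z + w, t + s + ½ Im (z · w̄))`. -/
def mul {n : ℕ} (x y : Heis n) : Heis n :=
  (x.1 + y.1, x.2 + y.2 + (1 / 2) * (∑ j, x.1 j * (starRingEnd ℂ) (y.1 j)).im)

/-- `(z,t)⁻¹ = (-z,-t)`. -/
def inv {n : ℕ} (x : Heis n) : Heis n := (-x.1, -x.2)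

theorem mul_inv_left {n : ℕ} (x : Heis n) : mul (inv x) x = (0, 0) := by
  have h : ∀ j, (-x.1 j * (starRingEnd ℂ) (x.1 j)).im = 0 := by
    intro j
    simp only [neg_mul, Complex.mul_conj, Complex.neg_im, Complex.ofReal_im, neg_zero]
  simp only [mul, inv, Pi.neg_apply, Complex.im_sum, h]
  simp

/-- The Laguerre polynomial `L_k^δ` of degree `k` and type `δ ∈ ℕ`:
`L_k^δ(t) = ∑_{j ≤ k} (-1)^j C(k+δ, k-j) t^j / j!`. -/
def laguerre (δ k : ℕ) (t : ℝ) : ℝ :=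
  ∑ j ∈ Finset.range (k + 1), (-1) ^ j * ((k + δ).choose (k - j) : ℝ) * t ^ j / (j ! : ℝ)

/-- The Laguerre function `φ^{n-1}_{k,l}(z) = L^{n-1}_k(½|l||z|²) exp(-¼|l||z|²)`. -/
def laguerreFun (n k : ℕ) (l : ℝ) (z : Cn n) : ℝ :=
  laguerre (n - 1) k ((1 / 2) * |l| * enorm2 z ^ 2) * Real.exp (-(1 / 4) * |l| * enorm2 z ^ 2)

/-- The joint eigenfunction `e_a(z,t) = e^{ilt} φ^{n-1}_{k,l}(z)` for `a = (l,(2k+n)|l|)`. -/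
def eigenFun (n k : ℕ) (l : ℝ) (x : Heis n) : ℂ :=
  Complex.exp (Complex.I * l * x.2) * laguerreFun n k l x.1

/-- The Bessel function of the first kind `J_m` of integer order `m ≥ 0`. -/
def besselJ (m : ℕ) (x : ℝ) : ℝ :=
  ∑' j : ℕ, (-1) ^ j / ((j ! : ℝ) * ((j + m)! : ℝ)) * (x / 2) ^ (2 * j + m)

/-- `2^{n-1} (n-1)! J_{n-1}(x) / x^{n-1}`, extended continuously by `1` at `x = 0`. -/
def sphericalBessel (n : ℕ) (x : ℝ) : ℝ :=
  if x = 0 then 1 else 2 ^ (n - 1) * ((n - 1)! : ℝ) * (besselJ (n - 1) x / x ^ (n - 1))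

/-- The Heisenberg fan `Ω ⊆ ℝ²`: the rays `R_k = {(l,(2k+n)|l|) : l ≠ 0}`, `k = 0,1,2,…`, and the
limiting ray `R_∞ = {(0,τ) : τ ≥ 0}`. -/
def fan (n : ℕ) : Set (ℝ × ℝ) :=
  (⋃ k : ℕ, {a | ∃ l : ℝ, l ≠ 0 ∧ a = (l, (2 * k + n) * |l|)}) ∪ {a | a.1 = 0 ∧ 0 ≤ a.2}

/-- The fan as a topological and measurable subspace of `ℝ²`. -/
abbrev Fan (n : ℕ) : Type := fan n

/-- The parametrization `l ↦ (l,(2k+n)|l|)` of `R_k` (for `l = 0` it gives the origin, which lies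
on `R_∞`). -/
def ray (n k : ℕ) (l : ℝ) : Fan n :=
  ⟨(l, (2 * k + n) * |l|), by
    by_cases h : l = 0
    · right; simp [h]
    · left; exact Set.mem_iUnion.2 ⟨k, l, h, rfl⟩⟩

open Classical in
/-- The index `k` of the ray `R_k` through a point of the fan with nonzero first coordinate
(irrelevant value `0` on `R_∞`). -/
def rayIndex {n : ℕ} (a : Fan n) : ℕ :=
  if h : ∃ k : ℕ, a.1.1 ≠ 0 ∧ a = ray n k a.1.1 then h.choose else 0

theorem rayIndex_ray (n k : ℕ) {l : ℝ} (hl : l ≠ 0) : rayIndex (ray n k l) = k := by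
  have key : ∀ m : ℕ, ray n k l = ray n m l → m = k := by
    intro m hm
    have h3 : (2 * (k : ℝ) + n) * |l| = (2 * (m : ℝ) + n) * |l| :=
      congrArg (fun a : Fan n => a.1.2) hm
    have h4 := mul_right_cancel₀ (abs_ne_zero.2 hl) h3
    have h5 : (m : ℝ) = (k : ℝ) := by linarith
    exact_mod_cast h5
  have h : ∃ k' : ℕ, (ray n k l).1.1 ≠ 0 ∧ ray n k l = ray n k' (ray n k l).1.1 := ⟨k, hl, rfl⟩
  rw [rayIndex, dif_pos h]
  exact key _ h.choose_spec.2

theorem measurable_ray (n k : ℕ) : Measurable (ray n k) := by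
  apply Measurable.subtype_mk
  fun_prop

/-- The constant `c_{n,k} = k! (n-1)! / (k+n-1)!`. -/
def c (n k : ℕ) : ℝ := (k ! : ℝ) * ((n - 1)! : ℝ) / ((k + n - 1)! : ℝ)

/-- The measure `ν₂` on the fan:
`∫ φ dν₂ = (2π)^{-2n-1} ∫_ℝ ∑_k c_{n,k}⁻² φ(l,(2k+n)|l|) |l|^{2n} dl`; see `lintegral_nu2`. -/
def nu2 (n : ℕ) : Measure (Fan n) :=
  ENNReal.ofReal (((2 * Real.pi) ^ (2 * n + 1))⁻¹) •
    Measure.sum fun k : ℕ => ENNReal.ofReal ((c n k ^ 2)⁻¹) •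
      Measure.map (ray n k) (volume.withDensity fun l : ℝ => ENNReal.ofReal (|l| ^ (2 * n)))

theorem lintegral_nu2 (n : ℕ) {g : Fan n → ℝ≥0∞} (hg : Measurable g) :
    ∫⁻ a, g a ∂(nu2 n) = ENNReal.ofReal (((2 * Real.pi) ^ (2 * n + 1))⁻¹) *
      ∫⁻ l : ℝ, (∑' k : ℕ, ENNReal.ofReal ((c n k ^ 2)⁻¹) * g (ray n k l)) *
        ENNReal.ofReal (|l| ^ (2 * n)) := by
  have hd : Measurable fun l : ℝ => ENNReal.ofReal (|l| ^ (2 * n)) := by fun_prop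
  have hr : ∀ k, Measurable fun l => g (ray n k l) := fun k => hg.comp (measurable_ray n k)
  simp only [← ENNReal.tsum_mul_right]
  have hm : ∀ k : ℕ, AEMeasurable (fun l : ℝ => ENNReal.ofReal ((c n k ^ 2)⁻¹) * g (ray n k l) *
      ENNReal.ofReal (|l| ^ (2 * n))) volume :=
    fun k => (((hr k).const_mul _).mul hd).aemeasurable
  rw [lintegral_tsum hm]
  simp only [nu2, lintegral_smul_measure, lintegral_sum_measure, smul_eq_mul]
  congr 2
  ext k
  rw [lintegral_map hg (measurable_ray n k), lintegral_withDensity_eq_lintegral_mul _ hd (hr k),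
    ← lintegral_const_mul _ (hd.mul (hr k))]
  congr 1
  ext l
  simp only [Pi.mul_apply]
  ring

/-- The normalized Strichartz Fourier transform `𝓕(f)` on `Ω × ℂⁿ` of an integrable `f`:
`c_{n,k} ∫ f(z,t) e_a((z,t)⁻¹(w,0)) dz dt` for `a = (l,(2k+n)|l|) ∈ R_k`, and
`2^{n-1}(n-1)! ∫ f(z,t) J_{n-1}(√τ|w-z|) / (√τ|w-z|)^{n-1} dz dt` for `a = (0,τ) ∈ R_∞`.
A function in `L²` that vanishes a.e. off a set of finite measure is integrable, so that for such
functions the integrals converge absolutely and no extension by density is involved. -/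
def transform {n : ℕ} (f : Heis n → ℂ) (p : Fan n × Cn n) : ℂ :=
  if p.1.1.1 = 0 then
    ∫ x : Heis n, f x * (sphericalBessel n (Real.sqrt p.1.1.2 * enorm2 (p.2 - x.1)) : ℂ)
  else
    (c n (rayIndex p.1) : ℂ) *
      ∫ x : Heis n, f x * eigenFun n (rayIndex p.1) p.1.1.1 (mul (inv x) (p.2, 0))

end Strichartz

end

/-! ### Benedicks' theorem on the real line, by periodization. -/

namespace Strichartz

open Set Filter Topology FourierTransform ComplexConjugate

/-! The problem is reduced to Benedicks' theorem in the central variable `t`. Write `f^l(z) = ∫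
f(z,t) e^{-ilt} dt`. Let `E` be the set of `l` for which some ray point `(l,(2k+n)|l|)` lies in a
measurable hull of `W`. Where `|l| ≥ M` the density of `ν₂` on each ray is bounded below uniformly
in `k`, since `c_{n,k} ≤ 1`, so `E` has finite Lebesgue measure
(`volume_iUnion_ray_preimage_lt_top`). For almost every `l ∉ E` the transform vanishes on all the
rays at once, and completeness of the Laguerre functions gives `f^l = 0`
(`ae_integral_central_eq_zero`). Hence for almost every `z` the slice `f(z,·)` is supported in a set
of finite measure, and so is its Fourier transform; `benedicks_real` makes it zero.

Completeness is proved without spectral theory. For fixed `w`, the Laguerre conditions give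
vanishing moments of `f`, times a phase, against `|z-w|^{2j} e^{-s|z-w|²}` with `s = |l|/4`. Taylor
expansion of the exponential raises `s` by the factor `3/2`, and iteration yields Gaussians
concentrating at `w`. There the phase becomes `e^{-ilt}`, so an approximate identity recovers `f^l`.

For Benedicks' theorem, the support is covered by an open `U` of measure less than `L`. For almost
every `ξ` only finitely many points of `ξ + L⁻¹ℤ` meet the support of `𝓕 g`, so the
`L`-periodization of the modulated `g` is a trigonometric polynomial. It vanishes on a set of
positive measure, hence identically, and `𝓕 g ξ = 0`. -/

theorem tsum_volume_translate_inter_Ioc {p : ℝ} (hp : 0 < p) (a : ℝ) {A : Set ℝ}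
    (hA : MeasurableSet A) :
    ∑' m : ℤ, volume ((fun x => x + m • p) ⁻¹' A ∩ Ioc a (a + p)) = volume A := by
  have h1 : A = ⋃ m : ℤ, A ∩ Ioc (a + m • p) (a + (m + 1) • p) := by
    rw [← inter_iUnion, iUnion_Ioc_add_zsmul hp, inter_univ]
  conv_rhs => rw [h1]
  rw [measure_iUnion]
  · congr 1
    ext m
    rw [← measure_preimage_add_right volume (m • p) (A ∩ _)]
    congr 1
    ext x
    simp only [mem_inter_iff, mem_preimage, mem_Ioc, add_smul, one_smul]
    constructor
    · rintro ⟨h, h1, h2⟩; exact ⟨h, by linarith, by linarith⟩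
    · rintro ⟨h, h1, h2⟩; exact ⟨h, by linarith, by linarith⟩
  · intro i j hij
    exact (pairwise_disjoint_Ioc_add_zsmul a p hij).mono inter_subset_right inter_subset_right
  · intro m
    exact hA.inter measurableSet_Ioc

/-- In the fundamental domain `(0, L]`, the image of `U` is covered by the translated pieces of `U`,
whose measures add up to that of `U`. Openness of `U` makes the image measurable. -/
theorem volume_coe_image_le {L : ℝ} [hL : Fact (0 < L)] {U : Set ℝ} (hU : IsOpen U) :
    volume (((↑) : ℝ → AddCircle L) '' U) ≤ volume U := by
  have hopen : IsOpen (((↑) : ℝ → AddCircle L) '' U) := QuotientAddGroup.isOpenMap_coe U hU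
  rw [AddCircle.add_projection_respects_measure L 0 hopen.measurableSet,
    ← tsum_volume_translate_inter_Ioc hL.out 0 hU.measurableSet]
  refine (measure_mono ?_).trans (measure_iUnion_le _)
  rintro x ⟨⟨u, hu, hux⟩, hx⟩
  have h : (u : AddCircle L) = (x : AddCircle L) := hux
  obtain ⟨m, hm⟩ := AddSubgroup.mem_zmultiples_iff.1 (QuotientAddGroup.eq.1 h.symm)
  refine mem_iUnion.2 ⟨m, ?_, hx⟩
  have h2 : x + m • L = u := by rw [hm]; ring
  simpa only [mem_preimage, h2] using hu

/-- Borel–Cantelli on each period: the translates of `A` cut to one period have summable measures,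
with total `volume A`. -/
theorem ae_finite_translates_mem {p : ℝ} (hp : 0 < p) {A : Set ℝ} (hA : MeasurableSet A)
    (hfin : volume A ≠ ⊤) : ∀ᵐ x : ℝ, {m : ℤ | x + m • p ∈ A}.Finite := by
  have key : ∀ a : ℝ, ∀ᵐ x ∂(volume.restrict (Ioc a (a + p))), {m : ℤ | x + m • p ∈ A}.Finite := by
    intro a
    refine ae_finite_setOfPred_mem (s := fun m : ℤ => (fun x : ℝ => x + m • p) ⁻¹' A) ?_
    have : ∀ m : ℤ, MeasurableSet ((fun x : ℝ => x + m • p) ⁻¹' A) := fun m =>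
      hA.preimage (by fun_prop)
    simp only [Measure.restrict_apply (this _)]
    rwa [tsum_volume_translate_inter_Ioc hp a hA]
  have h : ∀ᵐ x ∂(volume.restrict (⋃ m : ℤ, Ioc (m • p) ((m + 1) • p))),
      {m : ℤ | x + m • p ∈ A}.Finite := by
    rw [ae_restrict_iUnion_iff]
    intro m
    have := key (m • p)
    rwa [show m • p + p = (m + 1) • p by rw [add_smul, one_smul]] at this
  rwa [iUnion_Ioc_zsmul hp, Measure.restrict_univ] at h

/-- Duality: a test function `ψ` is the Fourier transform of a Schwartz function `Ψ`, so `∫ g ψ = ∫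
𝓕 g · Ψ = 0`. -/
theorem ae_eq_zero_of_fourier_eq_zero {g : ℝ → ℂ} (hg : Integrable g) (h : ∀ᵐ ξ, 𝓕 g ξ = 0) :
    g =ᵐ[volume] 0 := by
  refine ae_eq_zero_of_integral_contDiff_smul_eq_zero hg.locallyIntegrable fun ψ hψ hψc => ?_
  have h₁ : HasCompactSupport (Complex.ofRealCLM ∘ ψ) := hψc.comp_left rfl
  have h₂ : ContDiff ℝ (⊤ : ℕ∞) (Complex.ofRealCLM ∘ ψ) :=
    Complex.ofRealCLM.contDiff.comp hψ
  set Φ : SchwartzMap ℝ ℂ := h₁.toSchwartzMap h₂ with hΦ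
  let Ψ : SchwartzMap ℝ ℂ := 𝓕⁻ Φ
  have h3 : ∀ t, 𝓕 (Ψ : ℝ → ℂ) t = ψ t := by
    intro t
    have : 𝓕 Ψ = Φ := FourierTransform.fourier_fourierInv_eq Φ
    rw [← SchwartzMap.fourier_coe, this]
    rfl
  have h4 := VectorFourier.integral_fourierIntegral_smul_eq_flip (L := innerₗ ℝ)
      Real.continuous_fourierChar continuous_inner hg (SchwartzMap.integrable (μ := volume) Ψ)
  have h5 : ∫ ξ, 𝓕 g ξ • Ψ ξ = ∫ x, g x • 𝓕 (Ψ : ℝ → ℂ) x := by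
    simpa using! h4
  simp only [h3] at h5
  rw [integral_eq_zero_of_ae] at h5
  · rw [h5]
    congr 1
    ext x
    rw [Complex.real_smul, smul_eq_mul, mul_comm]
  · filter_upwards [h] with ξ hξ
    simp [hξ]

/-- Multiplication by `fourier N` clears the negative frequencies and leaves an ordinary polynomial
in the injective function `fourier 1`, which cannot have infinitely many roots. -/
theorem trigPoly_coeff_eq_zero {L : ℝ} [hL : Fact (0 < L)] (F : Finset ℤ) (b : ℤ → ℂ)
    {K : Set (AddCircle L)} (hK : K.Infinite)
    (h : ∀ x ∈ K, ∑ m ∈ F, b m * fourier m x = 0) : ∀ m ∈ F, b m = 0 := by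
  obtain ⟨N, hN⟩ : ∃ N : ℕ, ∀ m ∈ F, 0 ≤ m + N := by
    refine ⟨∑ m ∈ F, m.natAbs, fun m hm => ?_⟩
    have := Finset.single_le_sum (f := fun m : ℤ => m.natAbs) (fun _ _ => Nat.zero_le _) hm
    zify at this
    have h2 := neg_abs_le m
    push_cast
    linarith
  let Q : Polynomial ℂ := ∑ m ∈ F, Polynomial.monomial (m + N).toNat (b m)
  have hroot : ∀ x ∈ K, Q.eval (fourier 1 x) = 0 := by
    intro x hx
    have h1 : Q.eval (fourier 1 x) = fourier N x * ∑ m ∈ F, b m * fourier m x := by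
      simp only [Q, Polynomial.eval_finsetSum, Polynomial.eval_monomial, Finset.mul_sum]
      refine Finset.sum_congr rfl fun m hm => ?_
      have : (fourier 1 x : ℂ) ^ (m + N).toNat = fourier (m + N) x := by
        conv_rhs => rw [← Int.toNat_of_nonneg (hN m hm)]
        rw [fourier_apply, fourier_apply, one_zsmul, natCast_zsmul, AddCircle.toCircle_nsmul,
          Circle.coe_pow]
      rw [this, _root_.fourier_add]
      ring
    rw [h1, h x hx, mul_zero]
  have hQ : Q = 0 := by
    refine Polynomial.eq_zero_of_infinite_isRoot Q ?_
    have hinj : Function.Injective (fun x : AddCircle L => (fourier 1 x : ℂ)) := by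
      intro x y hxy
      simp only [fourier_one] at hxy
      exact AddCircle.injective_toCircle hL.out.ne' (Circle.coe_injective hxy)
    refine (hK.image hinj.injOn).mono ?_
    rintro _ ⟨x, hx, rfl⟩
    exact hroot x hx
  intro m hm
  have h2 : Q.coeff (m + N).toNat = b m := by
    simp only [Q, Polynomial.finsetSum_coeff, Polynomial.coeff_monomial]
    rw [Finset.sum_eq_single m]
    · simp
    · intro k hk hkm
      rw [if_neg]
      intro heq
      have h3 := Int.toNat_of_nonneg (hN m hm)
      have h4 := Int.toNat_of_nonneg (hN k hk)
      apply hkm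
      omega
    · exact fun h => absurd hm h
  rw [← h2, hQ, Polynomial.coeff_zero]

/-- This identifies the periodization of `g`, as a measure on the circle, with `P` times Haar
measure. Both sides are bounded functionals of `ψ` that agree on the characters, whose span is
dense. -/
theorem integral_mul_coe_eq_integral_mul {L : ℝ} [hL : Fact (0 < L)] {g : ℝ → ℂ}
    (hg : Integrable g) (P : C(AddCircle L, ℂ))
    (h : ∀ m : ℤ, ∫ t, g t * fourier m (t : AddCircle L) =
      ∫ x, P x * fourier m x ∂AddCircle.haarAddCircle) (ψ : C(AddCircle L, ℂ)) :
    ∫ t, g t * ψ (t : AddCircle L) = ∫ x, P x * ψ x ∂AddCircle.haarAddCircle := by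
  have functional : ∀ {X : Type} [MeasurableSpace X] (μ : Measure X) (q : X → AddCircle L)
      (_ : Measurable q) (u : X → ℂ) (_ : Integrable u μ),
      ∃ Λ : C(AddCircle L, ℂ) →L[ℂ] ℂ, ∀ ψ, Λ ψ = ∫ x, u x * ψ (q x) ∂μ := by
    intro X _ μ q hq u hu
    have hint : ∀ ψ : C(AddCircle L, ℂ), Integrable (fun x => u x * ψ (q x)) μ := fun ψ =>
      hu.mul_bdd (c := ‖ψ‖) (ψ.continuous.measurable.comp hq).aestronglyMeasurable
        (Eventually.of_forall fun x => ψ.norm_coe_le_norm _)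
    refine ⟨LinearMap.mkContinuous
      { toFun := fun ψ => ∫ x, u x * ψ (q x) ∂μ
        map_add' := fun ψ₁ ψ₂ => by
          simp only [ContinuousMap.add_apply, mul_add]
          exact integral_add (hint _) (hint _)
        map_smul' := fun c ψ => by
          simp only [ContinuousMap.smul_apply, smul_eq_mul, RingHom.id_apply]
          rw [← integral_const_mul]
          congr 1; ext x; ring } (∫ x, ‖u x‖ ∂μ) ?_, fun ψ => rfl⟩
    intro ψ
    simp only [LinearMap.coe_mk, AddHom.coe_mk]
    rw [← integral_mul_const]
    refine norm_integral_le_of_norm_le (hu.norm.mul_const _) (Eventually.of_forall fun x => ?_)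
    rw [norm_mul]
    gcongr
    exact ψ.norm_coe_le_norm _
  obtain ⟨Λ₁, h₁⟩ := functional volume ((↑) : ℝ → AddCircle L) (by fun_prop) g hg
  obtain ⟨Λ₂, h₂⟩ := functional AddCircle.haarAddCircle id measurable_id P
    (P.continuous.integrable_of_hasCompactSupport (HasCompactSupport.of_compactSpace _))
  have heq : Λ₁ = Λ₂ := by
    refine ContinuousLinearMap.ext_on
      (Submodule.dense_iff_topologicalClosure_eq_top.2 (span_fourier_closure_eq_top (T := L))) ?_
    rintro _ ⟨m, rfl⟩
    simpa only [h₁, h₂, id_eq] using h m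
  rw [← h₁, heq, h₂]
  rfl

theorem integral_trigPoly_mul_fourier {L : ℝ} [hL : Fact (0 < L)] (F : Finset ℤ) (b : ℤ → ℂ)
    (k : ℤ) :
    ∫ x : AddCircle L, (∑ m ∈ F, b m * fourier (-m) x) * fourier k x ∂AddCircle.haarAddCircle =
      if k ∈ F then b k else 0 := by
  have e1 : ∀ m : ℤ, ∫ x : AddCircle L, fourier (-m) x * fourier k x ∂AddCircle.haarAddCircle =
      if m = k then 1 else 0 := by
    intro m
    have := congrFun (fourierCoeff_fourier (T := L) (-m)) (-k)
    rw [fourierCoeff] at this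
    simp only [neg_neg, smul_eq_mul] at this
    rw [show (fun x : AddCircle L => (fourier (-m) x : ℂ) * fourier k x) =
      fun x => fourier k x * fourier (-m) x from funext fun x => mul_comm _ _, this,
      Pi.single_apply]
    simp [eq_comm]
  simp only [Finset.sum_mul]
  rw [integral_finsetSum]
  · simp only [mul_assoc, integral_const_mul, e1]
    simp only [mul_ite, mul_one, mul_zero, Finset.sum_ite_eq']
  · intro m _
    refine Continuous.integrable_of_hasCompactSupport ?_ (HasCompactSupport.of_compactSpace _)
    exact (continuous_const.mul (map_continuous (fourier (-m)))).mul (map_continuous (fourier k))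

/-- The periodization of `g` has no mass on the complement `K` of the image of `U`, so `∫_K |P|² =
0`. Since `volume U < L`, `K` has positive measure, and a finite zero set could not contain almost
all of it. -/
theorem infinite_zeros_of_vanishing {L : ℝ} [hL : Fact (0 < L)] {g : ℝ → ℂ}
    (hg : Integrable g) {U : Set ℝ} (hU : IsOpen U) (hUL : volume U < ENNReal.ofReal L)
    (hgU : ∀ t, t ∉ U → g t = 0) (P : C(AddCircle L, ℂ))
    (hcoef : ∀ m : ℤ, ∫ t, g t * fourier m (t : AddCircle L) =
      ∫ x, P x * fourier m x ∂AddCircle.haarAddCircle) :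
    {x : AddCircle L | P x = 0}.Infinite := by
  have hΛ := integral_mul_coe_eq_integral_mul hg P hcoef
  set K : Set (AddCircle L) := (((↑) : ℝ → AddCircle L) '' U)ᶜ with hKdef
  have hopen : IsOpen (((↑) : ℝ → AddCircle L) '' U) := QuotientAddGroup.isOpenMap_coe U hU
  have hKc : IsClosed K := hopen.isClosed_compl
  have hKpos : AddCircle.haarAddCircle K ≠ 0 := by
    intro h0
    have h1 : volume K = 0 := by
      rw [AddCircle.volume_eq_smul_haarAddCircle]; simp [h0]
    have h2 : volume (Set.univ : Set (AddCircle L)) ≤ volume U := by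
      rw [← union_compl_self (((↑) : ℝ → AddCircle L) '' U)]
      refine (measure_union_le _ _).trans ?_
      rw [← hKdef, h1, add_zero]
      exact volume_coe_image_le hU
    rw [AddCircle.measure_univ] at h2
    exact absurd hUL (not_lt.2 h2)
  let δ : ℕ → ℝ := fun n => 1 / ((n : ℝ) + 1)
  have hδ : ∀ n, 0 < δ n := fun n => by positivity
  have hδ0 : Tendsto δ atTop (𝓝 0) := tendsto_one_div_add_atTop_nhds_zero_nat
  -- The duality is available only for continuous test functions, so `conj P · 1_K` is reached as
  -- the limit of `conj P · θ n`.
  let θ : ℕ → C(AddCircle L, ℂ) := fun n =>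
    ⟨fun x => ((thickenedIndicator (hδ n) K x : ℝ) : ℂ), by fun_prop⟩
  have hθ1 : ∀ n x, ‖θ n x‖ ≤ 1 := by
    intro n x
    simp only [θ, ContinuousMap.coe_mk, Complex.norm_real, Real.norm_eq_abs, NNReal.abs_eq]
    exact_mod_cast thickenedIndicator_le_one (hδ n) K x
  have hθlim : ∀ x, Tendsto (fun n => θ n x) atTop (𝓝 (K.indicator (fun _ => (1 : ℂ)) x)) := by
    intro x
    have := tendsto_pi_nhds.1 (thickenedIndicator_tendsto_indicator_closure hδ hδ0 K) x
    rw [hKc.closure_eq] at this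
    have h3 := ((Complex.continuous_ofReal.comp NNReal.continuous_coe).tendsto _).comp this
    have h4 : (Complex.ofReal ∘ NNReal.toReal) (K.indicator (fun _ => 1) x) =
        K.indicator (fun _ => (1 : ℂ)) x := by
      by_cases hx : x ∈ K <;> simp [hx]
    rw [h4] at h3
    exact h3
  have hPb : ∀ x, ‖conj (P x)‖ ≤ ‖P‖ := fun x => by
    rw [RCLike.norm_conj]; exact P.norm_coe_le_norm x
  have hΛθ : ∀ n, ∫ t, g t * (conj (P (t : AddCircle L)) * θ n (t : AddCircle L)) =
      ∫ x, P x * (conj (P x) * θ n x) ∂AddCircle.haarAddCircle := fun n =>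
    hΛ ((star P) * θ n)
  have lim1 : Tendsto (fun n => ∫ t, g t * (conj (P (t : AddCircle L)) * θ n (t : AddCircle L)))
      atTop (𝓝 (∫ t, g t * (conj (P (t : AddCircle L)) *
        K.indicator (fun _ => (1 : ℂ)) (t : AddCircle L)))) := by
    refine tendsto_integral_of_dominated_convergence (fun t => ‖g t‖ * ‖P‖) ?_
      (hg.norm.mul_const _) ?_ ?_
    · intro n
      refine hg.1.mul (Continuous.aestronglyMeasurable ?_)
      exact ((star P) * θ n).continuous.comp (AddCircle.continuous_mk' L)
    · intro n
      refine Eventually.of_forall fun t => ?_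
      rw [norm_mul, norm_mul]
      gcongr
      calc _ ≤ ‖P‖ * 1 := by
            gcongr
            · exact hPb _
            · exact hθ1 _ _
        _ = _ := mul_one _
    · refine Eventually.of_forall fun t => ?_
      exact ((hθlim _).const_mul _).const_mul _
  have lim2 : Tendsto (fun n => ∫ x, P x * (conj (P x) * θ n x) ∂AddCircle.haarAddCircle)
      atTop (𝓝 (∫ x, P x * (conj (P x) *
        K.indicator (fun _ => (1 : ℂ)) x) ∂AddCircle.haarAddCircle)) := by
    refine tendsto_integral_of_dominated_convergence (fun t => ‖P‖ * ‖P‖) ?_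
      (integrable_const _) ?_ ?_
    · intro n
      exact (P * ((star P) * θ n)).continuous.aestronglyMeasurable
    · intro n
      refine Eventually.of_forall fun t => ?_
      rw [norm_mul, norm_mul]
      gcongr
      · exact P.norm_coe_le_norm t
      calc _ ≤ ‖P‖ * 1 := by
            gcongr
            · exact hPb _
            · exact hθ1 _ _
        _ = _ := mul_one _
    · refine Eventually.of_forall fun t => ?_
      exact ((hθlim _).const_mul _).const_mul _
  have hzero : ∫ t, g t * (conj (P (t : AddCircle L)) *
        K.indicator (fun _ => (1 : ℂ)) (t : AddCircle L)) = 0 := by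
    rw [← integral_zero ℝ ℂ (μ := volume)]
    congr 1
    ext t
    by_cases ht : t ∈ U
    · have : (t : AddCircle L) ∉ K := fun h => h ⟨t, ht, rfl⟩
      simp [this]
    · simp [hgU t ht]
  have hPK : ∫ x in K, ‖P x‖ ^ 2 ∂AddCircle.haarAddCircle = 0 := by
    simp only [hΛθ] at lim1
    have h5 := (tendsto_nhds_unique lim1 lim2).symm
    rw [hzero] at h5
    rw [← integral_indicator hKc.measurableSet]
    have h6 : ∀ x, P x * (conj (P x) * K.indicator (fun _ => (1 : ℂ)) x) =
        ((K.indicator (fun x => ‖P x‖ ^ 2) x : ℝ) : ℂ) := by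
      intro x
      by_cases hx : x ∈ K
      · simp [hx, Complex.mul_conj, Complex.normSq_eq_norm_sq]
      · simp [hx]
    simp only [h6] at h5
    exact_mod_cast h5
  rw [setIntegral_eq_zero_iff_of_nonneg_ae (Eventually.of_forall fun x => by positivity)
    (Continuous.integrable_of_hasCompactSupport (by fun_prop)
      (HasCompactSupport.of_compactSpace _)).integrableOn] at hPK
  have hPK' : ∀ᵐ x ∂AddCircle.haarAddCircle, x ∈ K → P x = 0 := by
    filter_upwards [(ae_restrict_iff' hKc.measurableSet).1 hPK] with x hx hxK
    simpa using hx hxK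
  have hsing : ∀ x : AddCircle L, AddCircle.haarAddCircle {x} = 0 := by
    intro x
    have h0 : volume {x} = 0 := by
      rw [← Metric.closedBall_zero, AddCircle.volume_closedBall]
      simp [hL.out.le]
    rw [AddCircle.volume_eq_smul_haarAddCircle] at h0
    simpa [hL.out.not_ge] using h0
  have : NullSingletonClass (AddCircle.haarAddCircle (T := L)) := ⟨hsing⟩
  intro hf
  apply hKpos
  refine measure_mono_null (t := {x | ¬ (x ∈ K → P x = 0)} ∪ {x | P x = 0}) ?_
    (measure_union_null hPK' (hf.measure_zero _))
  intro x hx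
  by_cases h : P x = 0
  · exact Or.inr h
  · exact Or.inl fun h' => h (h' hx)

theorem coeff_eq_zero_of_vanishing {L : ℝ} [hL : Fact (0 < L)] {g : ℝ → ℂ}
    (hg : Integrable g) {U : Set ℝ} (hU : IsOpen U) (hUL : volume U < ENNReal.ofReal L)
    (hgU : ∀ t, t ∉ U → g t = 0)
    (hfin : {m : ℤ | ∫ t, g t * fourier m (t : AddCircle L) ≠ 0}.Finite) (m : ℤ) :
    ∫ t, g t * fourier m (t : AddCircle L) = 0 := by
  obtain ⟨b, hb⟩ : ∃ b : ℤ → ℂ, ∀ m, b m = ∫ t, g t * fourier m (t : AddCircle L) :=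
    ⟨_, fun _ => rfl⟩
  simp only [← hb] at hfin ⊢
  have hF : ∀ k, k ∈ hfin.toFinset ↔ b k ≠ 0 := fun k => hfin.mem_toFinset
  -- The frequency is `-m` because `b m` pairs `g` with `fourier m` itself, not with its conjugate.
  let P : C(AddCircle L, ℂ) := ∑ m ∈ hfin.toFinset, b m • fourier (-m)
  have hP : ∀ x, P x = ∑ m ∈ hfin.toFinset, b m * fourier (-m) x := fun x => by
    simp only [P, ContinuousMap.sum_apply, ContinuousMap.smul_apply, smul_eq_mul]
  have hinf := infinite_zeros_of_vanishing hg hU hUL hgU P fun k => by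
    simp only [hP]
    rw [integral_trigPoly_mul_fourier, ← hb]
    split_ifs with hk
    · rfl
    · rw [hF, not_not] at hk
      exact hk
  by_contra hm
  have hmF := (hF m).2 hm
  refine hm ?_
  have := trigPoly_coeff_eq_zero (hfin.toFinset.map (Equiv.neg ℤ).toEmbedding)
    (fun k => b (-k)) hinf ?_ (-m) ?_
  · simpa only [neg_neg] using this
  · intro x hx
    rw [Finset.sum_map]
    simp only [Equiv.coe_toEmbedding, Equiv.neg_apply, neg_neg]
    rw [← hP]
    exact hx
  · exact Finset.mem_map.2 ⟨m, hmF, rfl⟩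

/-- **Benedicks' theorem** on the line. -/
theorem benedicks_real {g : ℝ → ℂ} (hg : Integrable g) (hS : volume {t | g t ≠ 0} ≠ ⊤)
    (hT : volume {ξ | 𝓕 g ξ ≠ 0} ≠ ⊤) : g =ᵐ[volume] 0 := by
  obtain ⟨U, hSU, hU, hUfin⟩ := Set.exists_isOpen_lt_of_lt {t | g t ≠ 0} ⊤ hS.lt_top
  set L : ℝ := (volume U).toReal + 1 with hLdef
  have hLpos : 0 < L := by positivity
  have : Fact (0 < L) := ⟨hLpos⟩
  have hUL : volume U < ENNReal.ofReal L := by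
    rw [ENNReal.lt_ofReal_iff_toReal_lt hUfin.ne]; linarith
  have hcont : Continuous (𝓕 g) :=
    VectorFourier.fourierIntegral_continuous Real.continuous_fourierChar continuous_inner hg
  have hTm : MeasurableSet {ξ | 𝓕 g ξ ≠ 0} := (isOpen_ne_fun hcont continuous_const).measurableSet
  refine ae_eq_zero_of_fourier_eq_zero hg ?_
  filter_upwards [ae_finite_translates_mem (inv_pos.2 hLpos) hTm hT] with ξ hξ
  -- Modulation by `ξ` turns the circle coefficients into samples of `𝓕 g` on the coset `ξ + L⁻¹ℤ`;
  -- the coefficient of index `0` is `𝓕 g ξ`.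
  let G : ℝ → ℂ := fun t => Complex.exp (-2 * Real.pi * t * ξ * Complex.I) * g t
  have hG : Integrable G := by
    refine hg.bdd_mul (c := 1) (Continuous.aestronglyMeasurable (by fun_prop))
      (Eventually.of_forall fun t => le_of_eq ?_)
    rw [Complex.norm_exp]; simp
  have hcoef : ∀ m : ℤ, ∫ t, G t * fourier m (t : AddCircle L) = 𝓕 g (ξ + (-m) • L⁻¹) := by
    intro m
    rw [Real.fourier_real_eq_integral_exp_smul]
    congr 1
    ext t
    rw [fourier_coe_apply, smul_eq_mul]
    simp only [G]
    rw [mul_right_comm, ← Complex.exp_add]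
    congr 2
    push_cast
    rw [zsmul_eq_mul]
    push_cast
    field_simp
    ring
  have hfin : {m : ℤ | ∫ t, G t * fourier m (t : AddCircle L) ≠ 0}.Finite := by
    refine (hξ.preimage (neg_injective.injOn)).subset ?_
    intro m hm
    simpa only [mem_preimage, mem_ofPred_eq, ← hcoef] using hm
  have := coeff_eq_zero_of_vanishing hG hU hUL
    (fun t ht => by
      have : g t = 0 := by by_contra h; exact ht (hSU h)
      simp [G, this]) hfin 0
  rw [hcoef] at this
  simpa using this

end Strichartz

namespace Strichartz

open Set Filter Topology

/-! ### From Laguerre functions to Gaussians of increasing sharpness. -/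

section Moments

variable {X : Type*} [MeasurableSpace X] {μ : Measure X} {u : X → ℂ} {q : X → ℝ}

theorem pow_mul_exp_neg_le {s x : ℝ} (hs : 0 < s) (hx : 0 ≤ x) (j : ℕ) :
    x ^ j * Real.exp (-s * x) ≤ j ! / s ^ j := by
  have h := Real.pow_div_factorial_le_exp (s * x) (by positivity) j
  rw [div_le_iff₀ (by positivity), mul_pow] at h
  rw [le_div_iff₀ (by positivity), neg_mul, Real.exp_neg]
  have h2 := Real.exp_pos (s * x)
  rw [show x ^ j * (Real.exp (s * x))⁻¹ * s ^ j = (s ^ j * x ^ j) / Real.exp (s * x) by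
    field_simp, div_le_iff₀ h2]
  linarith

theorem integrable_mul_pow_mul_exp (hu : Integrable u μ) (hq : Measurable q) (hq0 : ∀ x, 0 ≤ q x)
    {s : ℝ} (hs : 0 < s) (j : ℕ) :
    Integrable (fun x => u x * ((q x ^ j * Real.exp (-s * q x) : ℝ) : ℂ)) μ := by
  refine hu.mul_bdd (c := j ! / s ^ j) (Measurable.aestronglyMeasurable (by fun_prop))
    (Eventually.of_forall fun x => ?_)
  rw [Complex.norm_real, Real.norm_of_nonneg (mul_nonneg (pow_nonneg (hq0 x) _)
    (Real.exp_pos _).le)]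
  exact pow_mul_exp_neg_le hs (hq0 x) j

/-- Vanishing of all moments against `exp (-s q)` propagates from `s` to `3 s / 2`, by expanding
`exp (-s q / 2)` in its Taylor series. -/
theorem moments_eq_zero_mul_three_halves (hu : Integrable u μ) (hq : Measurable q)
    (hq0 : ∀ x, 0 ≤ q x) {s : ℝ} (hs : 0 < s)
    (h : ∀ j : ℕ, ∫ x, u x * ((q x ^ j * Real.exp (-s * q x) : ℝ) : ℂ) ∂μ = 0) (j : ℕ) :
    ∫ x, u x * ((q x ^ j * Real.exp (-(s * (3 / 2)) * q x) : ℝ) : ℂ) ∂μ = 0 := by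
  have hexp : ∀ y : ℝ, HasSum (fun k : ℕ => y ^ k / k !) (Real.exp y) := fun y => by
    rw [Real.exp_eq_exp_ℝ]; exact NormedSpace.expSeries_div_hasSum_exp y
  let F : ℕ → X → ℂ := fun k x =>
    u x * ((q x ^ j * Real.exp (-s * q x) * ((-(s / 2) * q x) ^ k / k !) : ℝ) : ℂ)
  -- These majorants sum to `‖u‖ q^j e^{-sq/2}`, still integrable. Passing from `s` to `2s` in one
  -- step would leave `‖u‖ q^j`, with no decay.
  let bd : ℕ → X → ℝ := fun k x =>
    ‖u x‖ * (q x ^ j * Real.exp (-s * q x)) * ((s / 2 * q x) ^ k / k !)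
  have hbd : ∀ x, HasSum (fun k => bd k x)
      (‖u x‖ * (q x ^ j * Real.exp (-s * q x)) * Real.exp (s / 2 * q x)) := fun x =>
    (hexp _).mul_left _
  have hsum : HasSum (fun k => ∫ x, F k x ∂μ)
      (∫ x, u x * ((q x ^ j * Real.exp (-(s * (3 / 2)) * q x) : ℝ) : ℂ) ∂μ) := by
    refine hasSum_integral_of_dominated_convergence bd ?_ ?_ ?_ ?_ ?_
    · intro k
      exact hu.1.mul (Measurable.aestronglyMeasurable (by fun_prop))
    · refine fun k => Eventually.of_forall fun x => le_of_eq ?_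
      have := hq0 x
      simp only [F, bd]
      rw [norm_mul, Complex.norm_real, Real.norm_eq_abs, abs_mul, abs_div, abs_pow,
        neg_mul (s / 2), abs_neg, abs_of_nonneg (show 0 ≤ s / 2 * q x by positivity),
        abs_of_nonneg (show 0 ≤ q x ^ j * Real.exp (-s * q x) by positivity),
        Nat.abs_cast]
      ring
    · exact Eventually.of_forall fun x => (hbd x).summable
    · simp only [fun x => (hbd x).tsum_eq]
      refine (integrable_mul_pow_mul_exp hu hq hq0 (half_pos hs) j).norm.congr
        (Eventually.of_forall fun x => ?_)
      have := hq0 x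
      simp only
      rw [norm_mul, Complex.norm_real, Real.norm_of_nonneg (by positivity), mul_assoc, mul_assoc,
        ← Real.exp_add]
      congr 3
      ring
    · refine Eventually.of_forall fun x => ?_
      simp only [F]
      refine HasSum.mul_left _ ?_
      rw [Complex.hasSum_ofReal]
      have := (hexp (-(s / 2) * q x)).mul_left (q x ^ j * Real.exp (-s * q x))
      rwa [mul_assoc, ← Real.exp_add,
        show -s * q x + -(s / 2) * q x = -(s * (3 / 2)) * q x by ring] at this
  have hzero : ∀ k, ∫ x, F k x ∂μ = 0 := by
    intro k
    have : F k = fun x => (((-(s / 2)) ^ k / k ! : ℝ) : ℂ) *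
        (u x * ((q x ^ (j + k) * Real.exp (-s * q x) : ℝ) : ℂ)) := by
      ext x
      simp only [F]
      push_cast
      rw [mul_pow, pow_add]
      ring
    rw [this, integral_const_mul, h, mul_zero]
  simp only [hzero] at hsum
  exact hsum.unique hasSum_zero

/-- The Laguerre polynomial of degree `k` has leading coefficient `(-1)^k / k!`, so the passage from
monomials is triangular and can be inverted by strong induction. -/
theorem moments_eq_zero_of_laguerre (hu : Integrable u μ) (hq : Measurable q) (hq0 : ∀ x, 0 ≤ q x)
    (δ : ℕ) {a s : ℝ} (ha : a ≠ 0) (hs : 0 < s)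
    (h : ∀ k : ℕ, ∫ x, u x * ((laguerre δ k (a * q x) * Real.exp (-s * q x) : ℝ) : ℂ) ∂μ = 0)
    (j : ℕ) : ∫ x, u x * ((q x ^ j * Real.exp (-s * q x) : ℝ) : ℂ) ∂μ = 0 := by
  induction j using Nat.strong_induction_on with
  | _ k ih =>
    let co : ℕ → ℝ := fun j => (-1) ^ j * ((k + δ).choose (k - j) : ℝ) * a ^ j / (j ! : ℝ)
    have h1 : ∀ x, u x * ((laguerre δ k (a * q x) * Real.exp (-s * q x) : ℝ) : ℂ) =
        ∑ j ∈ Finset.range (k + 1),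
          (co j : ℂ) * (u x * ((q x ^ j * Real.exp (-s * q x) : ℝ) : ℂ)) := by
      intro x
      simp only [laguerre, co]
      push_cast
      rw [Finset.sum_mul, Finset.mul_sum]
      refine Finset.sum_congr rfl fun j _ => ?_
      rw [mul_pow]
      ring
    have h2 := h k
    simp only [h1] at h2
    rw [integral_finsetSum _ fun j _ =>
      (integrable_mul_pow_mul_exp hu hq hq0 hs j).const_mul _] at h2
    simp only [integral_const_mul] at h2
    rw [Finset.sum_range_succ, Finset.sum_eq_zero, zero_add] at h2
    · refine (mul_eq_zero.1 h2).resolve_left ?_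
      simp only [co, Nat.sub_self, Nat.choose_zero_right]
      norm_cast
      simp [ha, Nat.factorial_ne_zero]
    · intro j hj
      rw [ih j (Finset.mem_range.1 hj), mul_zero]

theorem integral_mul_exp_eq_zero_of_laguerre (hu : Integrable u μ) (hq : Measurable q)
    (hq0 : ∀ x, 0 ≤ q x) (δ : ℕ) {a s : ℝ} (ha : a ≠ 0) (hs : 0 < s)
    (h : ∀ k : ℕ, ∫ x, u x * ((laguerre δ k (a * q x) * Real.exp (-s * q x) : ℝ) : ℂ) ∂μ = 0)
    (m : ℕ) : ∫ x, u x * (Real.exp (-(s * (3 / 2) ^ m) * q x) : ℂ) ∂μ = 0 := by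
  have key : ∀ m j : ℕ,
      ∫ x, u x * ((q x ^ j * Real.exp (-(s * (3 / 2) ^ m) * q x) : ℝ) : ℂ) ∂μ = 0 := by
    intro m
    induction m with
    | zero => simpa using moments_eq_zero_of_laguerre hu hq hq0 δ ha hs h
    | succ m ih =>
      intro j
      have := moments_eq_zero_mul_three_halves hu hq hq0 (by positivity) ih j
      rwa [mul_assoc s, ← pow_succ] at this
  simpa using key m 0

end Moments

/-! ### The normalized Gaussian as an approximate identity on `ℂⁿ`. -/

section Gaussian

variable {n : ℕ}

theorem enorm2_sq (z : Cn n) : enorm2 z ^ 2 = ∑ j, ‖z j‖ ^ 2 :=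
  Real.sq_sqrt (Finset.sum_nonneg fun _ _ => by positivity)

theorem continuous_enorm2 : Continuous (enorm2 (n := n)) := by
  unfold enorm2; fun_prop

theorem norm_le_enorm2 (z : Cn n) : ‖z‖ ≤ enorm2 z := by
  refine (pi_norm_le_iff_of_nonneg (Real.sqrt_nonneg _)).2 fun j => Real.le_sqrt_of_sq_le ?_
  exact Finset.single_le_sum (f := fun j => ‖z j‖ ^ 2) (fun _ _ => by positivity)
    (Finset.mem_univ j)

theorem integrable_exp_neg_enorm2_sq : Integrable fun z : Cn n => Real.exp (-enorm2 z ^ 2) := by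
  have h : Integrable fun w : ℂ => Real.exp (-‖w‖ ^ 2) := by
    have := (GaussianFourier.integrable_cexp_neg_mul_sq_norm_add (V := ℂ) (b := 1)
      (by simp) 0 0).norm
    refine this.congr (Eventually.of_forall fun w => ?_)
    simp only [Complex.norm_exp]
    congr 1
    norm_cast
    simp
  have h2 := Integrable.fintype_prod (ι := Fin n) (f := fun _ w => Real.exp (-‖w‖ ^ 2))
    (μ := fun _ => (volume : Measure ℂ)) fun _ => h
  rw [volume_pi]
  refine h2.congr (Eventually.of_forall fun z => ?_)
  simp only
  rw [enorm2_sq, ← Real.exp_sum, Finset.sum_neg_distrib]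

/-- The Gaussian on `ℂⁿ`, normalized to have integral one. -/
noncomputable def gauss (z : Cn n) : ℝ :=
  (∫ w : Cn n, Real.exp (-enorm2 w ^ 2))⁻¹ * Real.exp (-enorm2 z ^ 2)

theorem gauss_nonneg (z : Cn n) : 0 ≤ gauss z :=
  mul_nonneg (inv_nonneg.2 (integral_exp_pos integrable_exp_neg_enorm2_sq).le) (Real.exp_pos _).le

theorem continuous_gauss : Continuous (gauss (n := n)) := by
  have := continuous_enorm2 (n := n)
  unfold gauss; fun_prop

theorem integral_gauss : ∫ z : Cn n, gauss z = 1 := by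
  simp only [gauss, integral_const_mul]
  exact inv_mul_cancel₀ (integral_exp_pos integrable_exp_neg_enorm2_sq).ne'

theorem tendsto_pow_norm_mul_gauss (d : ℕ) :
    Tendsto (fun z : Cn n => ‖z‖ ^ d * gauss z) (Bornology.cobounded (Cn n)) (𝓝 0) := by
  set A := (∫ w : Cn n, Real.exp (-enorm2 w ^ 2))⁻¹ with hA
  have hA0 : 0 ≤ A := inv_nonneg.2 (integral_exp_pos integrable_exp_neg_enorm2_sq).le
  have h1 := ((Real.tendsto_pow_mul_exp_neg_atTop_nhds_zero d).comp
    (tendsto_norm_cobounded_atTop (E := Cn n))).const_mul (A * Real.exp 1)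
  rw [mul_zero] at h1
  refine squeeze_zero (fun z => mul_nonneg (by positivity) (gauss_nonneg z)) (fun z => ?_) h1
  -- The sup norm is at most the Euclidean one, and `x² ≥ x - 1`; this reduces Gaussian decay to
  -- exponential decay in `‖z‖`.
  have h2 : Real.exp (-enorm2 z ^ 2) ≤ Real.exp 1 * Real.exp (-‖z‖) := by
    rw [← Real.exp_add, Real.exp_le_exp]
    have := norm_le_enorm2 z
    have := norm_nonneg z
    nlinarith [sq_nonneg (‖z‖ - 1)]
  calc ‖z‖ ^ d * gauss z ≤ ‖z‖ ^ d * (A * (Real.exp 1 * Real.exp (-‖z‖))) := by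
        unfold gauss; gcongr
    _ = _ := by simp only [Function.comp]; ring

theorem integral_gauss_scaled {r : ℝ} (hr : 0 < r) (z : Cn n) :
    ∫ w : Cn n, r ^ Module.finrank ℝ (Cn n) * gauss (r • (z - w)) = 1 := by
  rw [integral_const_mul, integral_sub_left_eq_self (fun w : Cn n => gauss (r • w)) volume z,
    Measure.integral_comp_smul_of_nonneg volume _ _ (hR := hr.le), integral_gauss, smul_eq_mul,
    mul_one, mul_inv_cancel₀ (by positivity)]

theorem gauss_le (z : Cn n) : gauss z ≤ (∫ w : Cn n, Real.exp (-enorm2 w ^ 2))⁻¹ := by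
  have h : 0 ≤ (∫ w : Cn n, Real.exp (-enorm2 w ^ 2))⁻¹ :=
    inv_nonneg.2 (integral_exp_pos integrable_exp_neg_enorm2_sq).le
  refine mul_le_of_le_one_right h (Real.exp_le_one_iff.2 ?_)
  have := sq_nonneg (enorm2 z)
  linarith

theorem gauss_smul (r : ℝ) (z : Cn n) :
    gauss (r • z) = (∫ w : Cn n, Real.exp (-enorm2 w ^ 2))⁻¹ *
      Real.exp (-(r ^ 2) * enorm2 z ^ 2) := by
  unfold gauss
  congr 2
  rw [enorm2_sq, enorm2_sq, neg_mul, Finset.mul_sum]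
  congr 1
  refine Finset.sum_congr rfl fun j _ => ?_
  rw [Pi.smul_apply, norm_smul, mul_pow, Real.norm_eq_abs, sq_abs]

end Gaussian

end Strichartz

namespace Strichartz

open Set Filter Topology

/-! ### Completeness of the Laguerre functions at a fixed central frequency. -/

section Completeness

variable {n : ℕ}

/-- The central character part of `e_a((z,t)⁻¹(w,0))`. -/
noncomputable def phase (l : ℝ) (x : Heis n) (w : Cn n) : ℂ :=
  Complex.exp (Complex.I * l * (mul (inv x) (w, 0)).2)

theorem norm_phase (l : ℝ) (x : Heis n) (w : Cn n) : ‖phase l x w‖ = 1 := by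
  unfold phase
  rw [mul_assoc, ← Complex.ofReal_mul, mul_comm, Complex.norm_exp_ofReal_mul_I]

theorem phase_self (l : ℝ) (x : Heis n) :
    phase l x x.1 = Complex.exp (-(Complex.I * l * x.2)) := by
  have h : ∀ j, (-x.1 j * (starRingEnd ℂ) (x.1 j)).im = 0 := by
    intro j
    simp only [neg_mul, Complex.mul_conj, Complex.neg_im, Complex.ofReal_im, neg_zero]
  simp only [phase, mul, inv, Pi.neg_apply, Complex.im_sum, h]
  simp

theorem continuous_phase (l : ℝ) :
    Continuous fun p : Heis n × Cn n => phase l p.1 p.2 := by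
  unfold phase mul inv
  simp only [Complex.im_sum]
  fun_prop

theorem eigenFun_eq (k : ℕ) (l : ℝ) (x : Heis n) (w : Cn n) :
    eigenFun n k l (mul (inv x) (w, 0)) = phase l x w *
      ((laguerre (n - 1) k ((1 / 2 * |l|) * enorm2 (x.1 - w) ^ 2) *
        Real.exp (-(1 / 4 * |l|) * enorm2 (x.1 - w) ^ 2) : ℝ) : ℂ) := by
  have h : enorm2 (mul (inv x) (w, 0)).1 = enorm2 (x.1 - w) := by
    unfold enorm2 mul inv
    congr 1
    refine Finset.sum_congr rfl fun j _ => ?_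
    simp only [Pi.add_apply, Pi.neg_apply, Pi.sub_apply]
    rw [← norm_neg]
    congr 2
    ring
  unfold eigenFun laguerreFun
  rw [h, phase, neg_mul]

/-- With `w` fixed, the phase does not depend on `k` and is absorbed into the integrable factor; the
moment argument then applies with `q = |z-w|²`. -/
theorem integral_phase_gauss_eq_zero {f : Heis n → ℂ} (hf : Integrable f) {l : ℝ} (hl : l ≠ 0)
    (w : Cn n)
    (h : ∀ k : ℕ, ∫ x, f x * eigenFun n k l (mul (inv x) (w, 0)) = 0) (m : ℕ) :
    ∫ x, f x * phase l x w *
      (gauss (Real.sqrt (1 / 4 * |l| * (3 / 2) ^ m) • (x.1 - w)) : ℂ) = 0 := by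
  have hl' : 0 < |l| := abs_pos.2 hl
  have hu : Integrable fun x => f x * phase l x w := by
    refine hf.mul_bdd (c := 1) ?_ (Eventually.of_forall fun x => (norm_phase l x w).le)
    exact ((continuous_phase l).comp (by fun_prop :
      Continuous fun x : Heis n => (x, w))).aestronglyMeasurable
  have hc := continuous_enorm2 (n := n)
  have := integral_mul_exp_eq_zero_of_laguerre hu (q := fun x => enorm2 (x.1 - w) ^ 2)
    (Continuous.measurable (by fun_prop)) (fun x => by positivity) (n - 1)
    (a := 1 / 2 * |l|) (s := 1 / 4 * |l|) (by positivity) (by positivity) (fun k => by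
      rw [← h k]
      congr 1
      ext x
      rw [eigenFun_eq, mul_assoc]) m
  simp only [gauss_smul]
  rw [Real.sq_sqrt (by positivity)]
  have h2 : ∀ x : Heis n, f x * phase l x w *
      (((∫ w : Cn n, Real.exp (-enorm2 w ^ 2))⁻¹ *
        Real.exp (-(1 / 4 * |l| * (3 / 2) ^ m) * enorm2 (x.1 - w) ^ 2) : ℝ) : ℂ) =
      (((∫ w : Cn n, Real.exp (-enorm2 w ^ 2))⁻¹ : ℝ) : ℂ) * (f x * phase l x w *
        (Real.exp (-(1 / 4 * |l| * (3 / 2) ^ m) * enorm2 (x.1 - w) ^ 2) : ℂ)) := by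
    intro x
    push_cast
    ring
  simp only [h2]
  rw [integral_const_mul, this, mul_zero]

/-- Integrating the Gaussian identities in `w` against `ψ` uses them only for almost every `w`.
After Fubini the inner integral over `w` is an approximate identity at `z`, where the phase reduces
to `e^{-ilt}`. -/
theorem integral_exp_mul_test_eq_zero {f : Heis n → ℂ} (hf : Integrable f) {l : ℝ} (hl : l ≠ 0)
    (h : ∀ k : ℕ, ∀ᵐ w : Cn n, ∫ x, f x * eigenFun n k l (mul (inv x) (w, 0)) = 0)
    {ψ : Cn n → ℝ} (hψ : Continuous ψ) (hψc : HasCompactSupport ψ) :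
    ∫ x : Heis n, f x * (Complex.exp (-(Complex.I * l * x.2)) * (ψ x.1 : ℂ)) = 0 := by
  have hl' : 0 < |l| := abs_pos.2 hl
  let r : ℕ → ℝ := fun m => Real.sqrt (1 / 4 * |l| * (3 / 2) ^ m)
  have hr : ∀ m, 0 < r m := fun m => by positivity
  have hrlim : Tendsto r atTop atTop := by
    refine Real.tendsto_sqrt_atTop.comp (Tendsto.const_mul_atTop (by positivity) ?_)
    exact tendsto_pow_atTop_atTop_of_one_lt (by norm_num)
  let d := Module.finrank ℝ (Cn n)
  let κ : ℕ → Cn n → Cn n → ℝ := fun m z w => r m ^ d * gauss (r m • (z - w))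
  have hκ0 : ∀ m z w, 0 ≤ κ m z w := fun m z w =>
    mul_nonneg (pow_nonneg (hr m).le _) (gauss_nonneg _)
  have hκc : ∀ m, Continuous fun p : Heis n × Cn n => κ m p.1.1 p.2 := by
    intro m
    have := continuous_gauss (n := n)
    fun_prop
  have hψi : Integrable (fun w => (ψ w : ℂ)) :=
    (hψ.integrable_of_hasCompactSupport hψc).ofReal
  obtain ⟨C, hC⟩ := hψc.exists_bound_of_continuous hψ
  have hph := continuous_phase (n := n) l
  have hz : ∀ m, ∫ x : Heis n, f x * ∫ w, (κ m x.1 w) • (phase l x w * (ψ w : ℂ)) = 0 := by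
    intro m
    have hint : Integrable (fun p : Heis n × Cn n =>
        f p.1 * (ψ p.2 : ℂ) * (phase l p.1 p.2 * (κ m p.1.1 p.2 : ℂ)))
        ((volume : Measure (Heis n)).prod volume) := by
      refine (hf.mul_prod hψi).mul_bdd
        (c := r m ^ d * (∫ w : Cn n, Real.exp (-enorm2 w ^ 2))⁻¹) ?_
        (Eventually.of_forall fun p => ?_)
      · exact (hph.mul (Complex.continuous_ofReal.comp (hκc m))).aestronglyMeasurable
      · rw [norm_mul, norm_phase, one_mul, Complex.norm_real, Real.norm_of_nonneg (hκ0 _ _ _)]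
        exact mul_le_mul_of_nonneg_left (gauss_le _) (pow_nonneg (hr m).le _)
    have hswap := integral_integral_swap (f := fun (x : Heis n) (w : Cn n) =>
      f x * (ψ w : ℂ) * (phase l x w * (κ m x.1 w : ℂ))) hint
    have e1 : ∀ x : Heis n, f x * ∫ w, (κ m x.1 w) • (phase l x w * (ψ w : ℂ)) =
        ∫ w, f x * (ψ w : ℂ) * (phase l x w * (κ m x.1 w : ℂ)) := by
      intro x
      rw [← integral_const_mul]
      congr 1
      ext w
      rw [Complex.real_smul]
      ring
    simp only [e1]
    rw [hswap]
    refine integral_eq_zero_of_ae ?_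
    filter_upwards [ae_all_iff.2 h] with w hw
    have e2 : ∀ x : Heis n, f x * (ψ w : ℂ) * (phase l x w * (κ m x.1 w : ℂ)) =
        ((ψ w * r m ^ d : ℝ) : ℂ) * (f x * phase l x w * (gauss (r m • (x.1 - w)) : ℂ)) := by
      intro x
      simp only [κ]
      push_cast
      ring
    simp only [e2]
    rw [integral_const_mul, integral_phase_gauss_eq_zero hf hl w hw m, mul_zero]
    rfl
  have hlim : ∀ x : Heis n, Tendsto (fun m => ∫ w, (κ m x.1 w) • (phase l x w * (ψ w : ℂ))) atTop
      (𝓝 (Complex.exp (-(Complex.I * l * x.2)) * (ψ x.1 : ℂ))) := by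
    intro x
    rw [← phase_self]
    have hpc : Continuous fun w => phase l x w := hph.comp (by fun_prop :
      Continuous fun w : Cn n => (x, w))
    have hg : Integrable fun w => phase l x w * (ψ w : ℂ) :=
      hψi.bdd_mul (c := 1) hpc.aestronglyMeasurable
        (Eventually.of_forall fun w => (norm_phase l x w).le)
    exact (tendsto_integral_comp_smul_smul_of_integrable' (μ := volume) gauss_nonneg integral_gauss
      (tendsto_pow_norm_mul_gauss _) (x₀ := x.1) hg
      (by fun_prop : Continuous fun w => phase l x w * (ψ w : ℂ)).continuousAt).comp hrlim
  have hb : ∀ m (x : Heis n), ‖∫ w, (κ m x.1 w) • (phase l x w * (ψ w : ℂ))‖ ≤ C := by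
    intro m x
    have hone : ∫ w, κ m x.1 w = 1 := integral_gauss_scaled (hr m) x.1
    calc _ ≤ ∫ w, κ m x.1 w * C := by
          refine norm_integral_le_of_norm_le
            ((integrable_of_integral_eq_one hone).mul_const C) (Eventually.of_forall fun w => ?_)
          rw [norm_smul, norm_mul (phase l x w), norm_phase, one_mul, Complex.norm_real,
            Real.norm_of_nonneg (hκ0 _ _ _)]
          exact mul_le_mul_of_nonneg_left (hC w) (hκ0 _ _ _)
      _ = C := by rw [integral_mul_const, hone, one_mul]
  have hmeas : ∀ m, AEStronglyMeasurable
      (fun x : Heis n => ∫ w, (κ m x.1 w) • (phase l x w * (ψ w : ℂ))) volume := by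
    intro m
    refine (StronglyMeasurable.integral_prod_right (Continuous.stronglyMeasurable ?_)
      ).aestronglyMeasurable
    have := hκc m
    exact this.smul (hph.mul (by fun_prop))
  have hconv := tendsto_integral_of_dominated_convergence
    (F := fun m x => f x * ∫ w, (κ m x.1 w) • (phase l x w * (ψ w : ℂ))) (fun x => ‖f x‖ * C)
    (fun m => hf.1.mul (hmeas m)) (hf.norm.mul_const C)
    (fun m => Eventually.of_forall fun x => by
      rw [norm_mul]; exact mul_le_mul_of_nonneg_left (hb m x) (norm_nonneg _))
    (Eventually.of_forall fun x => (hlim x).const_mul (f x))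
  simp only [hz] at hconv
  exact (tendsto_nhds_unique hconv tendsto_const_nhds)

/-- Completeness of the Laguerre expansion: if all twisted convolutions with the Laguerre functions
vanish, so does the partial Fourier transform in the central variable. -/
theorem ae_integral_central_eq_zero {f : Heis n → ℂ} (hf : Integrable f) {l : ℝ} (hl : l ≠ 0)
    (h : ∀ k : ℕ, ∀ᵐ w : Cn n, ∫ x, f x * eigenFun n k l (mul (inv x) (w, 0)) = 0) :
    ∀ᵐ z : Cn n, ∫ t : ℝ, f (z, t) * Complex.exp (-(Complex.I * l * t)) = 0 := by
  have hexp : ∀ t : ℝ, ‖Complex.exp (-(Complex.I * l * t))‖ = 1 := by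
    intro t
    rw [Complex.norm_exp]; simp
  have hF : Integrable fun x : Heis n => f x * Complex.exp (-(Complex.I * l * x.2)) :=
    hf.mul_bdd (c := 1) (Continuous.aestronglyMeasurable (by fun_prop))
      (Eventually.of_forall fun x => (hexp x.2).le)
  refine ae_eq_zero_of_integral_contDiff_smul_eq_zero
    (Integrable.integral_prod_left hF).locallyIntegrable fun ψ hψ hψc => ?_
  obtain ⟨C, hC⟩ := hψc.exists_bound_of_continuous hψ.continuous
  have h0 := integral_exp_mul_test_eq_zero hf hl h hψ.continuous hψc
  have hψ' := hψ.continuous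
  have hFψ : Integrable fun x : Heis n =>
      f x * (Complex.exp (-(Complex.I * l * x.2)) * (ψ x.1 : ℂ)) :=
    (hF.mul_bdd (c := C) (g := fun x => (ψ x.1 : ℂ))
      (Continuous.aestronglyMeasurable (by fun_prop))
      (Eventually.of_forall fun x => by rw [Complex.norm_real]; exact hC _)).congr
      (Eventually.of_forall fun x => by simp only [mul_assoc])
  rw [Measure.volume_eq_prod, integral_prod _ hFψ] at h0
  rw [← h0]
  congr 1
  ext z
  rw [Complex.real_smul, ← integral_const_mul]
  congr 1
  ext t
  ring

end Completeness

end Strichartz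

namespace Strichartz

open Set Filter Topology FourierTransform

/-! ### Measure theory on the fan and reduction to the central variable. -/

section Main

variable {n : ℕ}

theorem c_pos (n k : ℕ) : 0 < c n k := by
  unfold c; positivity

theorem c_le_one (hn : 1 ≤ n) (k : ℕ) : c n k ≤ 1 := by
  unfold c
  rw [div_le_one (by positivity), Nat.add_sub_assoc hn]
  exact_mod_cast Nat.le_of_dvd (Nat.factorial_pos _)
    (Nat.factorial_mul_factorial_dvd_factorial_add k (n - 1))

/-- All weights in `ν₂` are positive and its density on a ray vanishes only at `l = 0`, so null sets
of `ν₂` pull back to Lebesgue null sets. -/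
theorem ae_ray_of_ae_nu2 {p : Fan n → Prop} (h : ∀ᵐ a ∂(nu2 n), p a) (k : ℕ) :
    ∀ᵐ l : ℝ, p (ray n k l) := by
  unfold nu2 at h
  rw [Measure.ae_ennreal_smul_measure_iff (ENNReal.ofReal_pos.2 (by positivity)).ne',
    Measure.ae_sum_iff] at h
  have hk := h k
  have hck := c_pos n k
  rw [Measure.ae_ennreal_smul_measure_iff (ENNReal.ofReal_pos.2 (by positivity)).ne'] at hk
  have h2 := ae_of_ae_map (measurable_ray n k).aemeasurable hk
  rw [ae_withDensity_iff (by fun_prop)] at h2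
  have h0 : ∀ᵐ l : ℝ, l ≠ 0 := by simp [ae_iff]
  filter_upwards [h2, h0] with l hl hl0
  exact hl (ENNReal.ofReal_pos.2 (by positivity)).ne'

/-- On `A` the density on every ray is at least `M^{2n}`, and `c_{n,k}⁻² ≥ 1`. The sum over `k` of
the Lebesgue measures is therefore at most a constant times `nu2 n A`, which bounds the union. -/
theorem volume_iUnion_ray_preimage_lt_top (hn : 1 ≤ n) {M : ℝ} (hM : 0 < M) {A : Set (Fan n)}
    (hA : MeasurableSet A) (hAM : ∀ a ∈ A, M ≤ |a.1.1|) (hfin : nu2 n A < ⊤) :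
    volume (⋃ k : ℕ, ray n k ⁻¹' A) < ⊤ := by
  have hAk : ∀ k, MeasurableSet (ray n k ⁻¹' A) := fun k => measurable_ray n k hA
  set D := ENNReal.ofReal (((2 * Real.pi) ^ (2 * n + 1))⁻¹) with hD
  have hD0 : D ≠ 0 := (ENNReal.ofReal_pos.2 (by positivity)).ne'
  set m := ENNReal.ofReal (M ^ (2 * n)) with hm
  have hm0 : m ≠ 0 := (ENNReal.ofReal_pos.2 (by positivity)).ne'
  have key : D * (m * ∑' k : ℕ, volume (ray n k ⁻¹' A)) ≤ nu2 n A := by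
    rw [nu2, Measure.smul_apply, Measure.sum_apply _ hA, smul_eq_mul, ← ENNReal.tsum_mul_left]
    refine mul_le_mul_right (ENNReal.tsum_le_tsum fun k => ?_) D
    rw [Measure.smul_apply, Measure.map_apply (measurable_ray n k) hA,
      withDensity_apply _ (hAk k), smul_eq_mul]
    have h1 : 1 ≤ ENNReal.ofReal ((c n k ^ 2)⁻¹) := by
      rw [ENNReal.one_le_ofReal]
      exact (one_le_inv₀ (pow_pos (c_pos n k) 2)).2 (pow_le_one₀ (c_pos n k).le (c_le_one hn k))
    have h2 : m * volume (ray n k ⁻¹' A) ≤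
        ∫⁻ l in ray n k ⁻¹' A, ENNReal.ofReal (|l| ^ (2 * n)) := by
      rw [← setLIntegral_const]
      refine setLIntegral_mono' (hAk k) fun l hl => ENNReal.ofReal_le_ofReal ?_
      exact pow_le_pow_left₀ hM.le (hAM _ hl) _
    calc _ ≤ 1 * _ := by rw [one_mul]; exact h2
      _ ≤ _ := mul_le_mul_left h1 _
  refine (measure_iUnion_le _).trans_lt ?_
  by_contra h
  rw [not_lt, top_le_iff] at h
  rw [h, ENNReal.mul_top hm0, ENNReal.mul_top hD0, top_le_iff] at key
  exact hfin.ne key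

theorem transform_ray (f : Heis n → ℂ) (k : ℕ) {l : ℝ} (hl : l ≠ 0) (w : Cn n) :
    transform f (ray n k l, w) =
      (c n k : ℂ) * ∫ x, f x * eigenFun n k l (mul (inv x) (w, 0)) := by
  have h : (ray n k l).1.1 = l := rfl
  simp only [transform, h, hl, if_false, rayIndex_ray n k hl]

theorem integrable_of_memLp_two_of_support {f : Heis n → ℂ} (hf : MemLp f 2 volume)
    {V : Set (Heis n)} (hVfin : volume V < ⊤)
    (hfV : ∀ᵐ x ∂volume, x ∉ V → f x = 0) : Integrable f := by
  have : IsFiniteMeasure (volume.restrict V) := ⟨by simpa using hVfin⟩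
  have h : IntegrableOn f V := (hf.restrict V).integrable (by norm_num)
  have h2 : IntegrableOn f (toMeasurable volume V) := by
    rwa [IntegrableOn, Measure.restrict_toMeasurable hVfin.ne]
  refine (integrableOn_iff_integrable_of_support_subset (s := univ) (subset_univ _)).1 ?_
  refine IntegrableOn.of_ae_sdiff_eq_zero h2 nullMeasurableSet_univ ?_
  filter_upwards [hfV] with x hx hx2
  exact hx fun h3 => hx2.2 (subset_toMeasurable _ _ h3)

theorem fourier_eq_integral_exp (g : ℝ → ℂ) (ξ : ℝ) :
    𝓕 g ξ = ∫ t : ℝ, g t * Complex.exp (-(Complex.I * ((2 * Real.pi * ξ : ℝ) : ℂ) * t)) := by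
  rw [Real.fourier_real_eq_integral_exp_smul]
  congr 1
  ext t
  rw [smul_eq_mul, mul_comm]
  congr 2
  push_cast
  ring

/-- A function on the Heisenberg group supported in a set of finite measure vanishes if its
Fourier transform in the central variable is supported over a set of finite measure. -/
theorem ae_eq_zero_of_central_fourier_support {f : Heis n → ℂ} (hf : Integrable f)
    {V : Set (Heis n)} (hVfin : volume V < ⊤) (hfV : ∀ᵐ x ∂volume, x ∉ V → f x = 0)
    {E : Set ℝ} (hE : MeasurableSet E) (hEfin : volume E < ⊤)
    (h : ∀ᵐ l : ℝ, l ∉ E →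
      ∀ᵐ z : Cn n, ∫ t : ℝ, f (z, t) * Complex.exp (-(Complex.I * l * t)) = 0) :
    f =ᵐ[volume] 0 := by
  -- A strongly measurable representative makes the partial Fourier transform jointly measurable, as
  -- needed to exchange "almost every `l`" and "almost every `z`".
  set g := hf.1.mk f with hg
  have hgm : StronglyMeasurable g := hf.1.stronglyMeasurable_mk
  have hfg : f =ᵐ[volume] g := hf.1.ae_eq_mk
  have hgi : Integrable g := hf.congr hfg
  refine hfg.trans ?_
  let J : ℝ → Cn n → ℂ := fun l z => ∫ t : ℝ, g (z, t) * Complex.exp (-(Complex.I * l * t))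
  have hJm : StronglyMeasurable (fun p : ℝ × Cn n => J p.1 p.2) := by
    refine StronglyMeasurable.integral_prod_right
      (f := fun (p : ℝ × Cn n) (t : ℝ) => g (p.2, t) * Complex.exp (-(Complex.I * p.1 * t))) ?_
    refine StronglyMeasurable.mul (hgm.comp_measurable ?_) (Continuous.stronglyMeasurable ?_)
    · fun_prop
    · fun_prop
  have hslice : ∀ᵐ z : Cn n, ∀ᵐ t : ℝ, f (z, t) = g (z, t) := Measure.ae_ae_of_ae_prod hfg
  have hJ : ∀ᵐ l : ℝ, ∀ᵐ z : Cn n, l ∉ E → J l z = 0 := by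
    filter_upwards [h] with l hl
    by_cases hlE : l ∈ E
    · exact Eventually.of_forall fun z hz => absurd hlE hz
    · filter_upwards [hl hlE, hslice] with z hz hs _
      rw [← hz]
      refine integral_congr_ae ?_
      filter_upwards [hs] with t ht
      rw [ht]
  rw [Measure.ae_ae_comm] at hJ
  swap
  · have : MeasurableSet ({p : ℝ × Cn n | p.1 ∈ E} ∪ {p : ℝ × Cn n | J p.1 p.2 = 0}) :=
      (measurable_fst hE).union (hJm.measurable (measurableSet_singleton 0))
    convert this using 1
    ext p
    exact imp_iff_not_or.trans (by rw [not_not]; rfl)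
  have hNm : MeasurableSet {x | g x ≠ 0} := (hgm.measurable (measurableSet_singleton 0)).compl
  have hNfin : volume {x | g x ≠ 0} ≠ ⊤ := by
    refine ((measure_mono_ae ?_).trans_lt hVfin).ne
    filter_upwards [hfV, hfg] with x hx hx2 hxN
    by_contra hxV
    exact hxN (hx2 ▸ hx hxV)
  have hNslice : ∀ᵐ z : Cn n, volume (Prod.mk z ⁻¹' {x | g x ≠ 0}) < ⊤ :=
    Measure.ae_measure_lt_top hNm hNfin
  have hmain : ∀ᵐ z : Cn n, volume (Prod.mk z ⁻¹' {x | g x ≠ 0}) = 0 := by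
    filter_upwards [hJ, hNslice, hgi.prod_right_ae] with z hz hzN hzi
    refine (benedicks_real hzi hzN.ne ?_ : (fun t => g (z, t)) =ᵐ[volume] 0)
    -- The normalization of `𝓕` corresponds to `l = 2πξ`; the rescaling preserves finiteness of
    -- measure.
    have hset : {ξ | 𝓕 (fun t => g (z, t)) ξ ≠ 0} =
        (fun ξ => 2 * Real.pi * ξ) ⁻¹' {l | J l z ≠ 0} := by
      ext ξ
      simp only [J, mem_preimage, mem_ofPred_eq]
      rw [← fourier_eq_integral_exp]
    rw [hset, Real.volume_preimage_mul_left (by positivity)]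
    refine ENNReal.mul_ne_top ENNReal.ofReal_ne_top ((measure_mono_ae ?_).trans_lt hEfin).ne
    filter_upwards [hz] with l hl hlJ
    by_contra hlE
    exact hlJ (hl hlE)
  exact (Measure.measure_prod_null hNm).2 hmain

end Main

end Strichartz

theorem mainTheorem1 (n : ℕ) (hn : 1 ≤ n)
    (V : Set (Strichartz.Heis n)) (hV : NullMeasurableSet V volume) (hVfin : volume V < ⊤)
    (W : Set (Strichartz.Fan n)) (hW : NullMeasurableSet W (Strichartz.nu2 n))
    (hWfin : Strichartz.nu2 n W < ⊤)
    (M : ℝ) (hM : 0 < M)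
    (hWM : W ⊆ {a | ∃ (k : ℕ) (l : ℝ), M < |l| ∧ a = Strichartz.ray n k l})
    (B : Set (Strichartz.Cn n)) (hB : NullMeasurableSet B volume)
    (f : Strichartz.Heis n → ℂ) (hf : MemLp f 2 volume)
    (hfV : ∀ᵐ x ∂volume, x ∉ V → f x = 0)
    (hFW : ∀ᵐ p ∂((Strichartz.nu2 n).prod (volume : Measure (Strichartz.Cn n))),
      p ∉ W ×ˢ B → Strichartz.transform f p = 0) :
    f =ᵐ[volume] 0 := by
  have hfi := Strichartz.integrable_of_memLp_two_of_support hf hVfin hfV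
  -- The measurable hull of `W` may reach small `|l|`; cutting it by `M ≤ |l|` restores the lower
  -- bound on the density and still contains `W`.
  let A : Set (Strichartz.Fan n) := toMeasurable (Strichartz.nu2 n) W ∩ {a | M ≤ |a.1.1|}
  have hA : MeasurableSet A := (measurableSet_toMeasurable _ _).inter
    (measurableSet_le measurable_const (by fun_prop))
  have hWA : W ⊆ A := by
    intro a ha
    refine ⟨subset_toMeasurable _ _ ha, ?_⟩
    obtain ⟨k, l, hl, rfl⟩ := hWM ha
    exact hl.le
  have hAfin : Strichartz.nu2 n A < ⊤ :=
    (measure_mono Set.inter_subset_left).trans_lt (by rwa [measure_toMeasurable])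
  refine Strichartz.ae_eq_zero_of_central_fourier_support hfi hVfin hfV
    (MeasurableSet.iUnion fun k => Strichartz.measurable_ray n k hA)
    (Strichartz.volume_iUnion_ray_preimage_lt_top hn hM hA (fun a ha => ha.2) hAfin) ?_
  have h0 : ∀ᵐ l : ℝ, l ≠ 0 := by simp [ae_iff]
  -- Countability of the rays gives a single null set of `l` that serves all `k`.
  have hray := ae_all_iff.2
    (Strichartz.ae_ray_of_ae_nu2 (Measure.ae_ae_of_ae_prod hFW))
  filter_upwards [h0, hray] with l hl0 hl hlE
  refine Strichartz.ae_integral_central_eq_zero hfi hl0 fun k => ?_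
  filter_upwards [hl k] with w hw
  have hnot : (Strichartz.ray n k l, w) ∉ W ×ˢ B := fun h =>
    hlE (Set.mem_iUnion.2 ⟨k, hWA h.1⟩)
  have := hw hnot
  rw [Strichartz.transform_ray f k hl0] at this
  exact (mul_eq_zero.1 this).resolve_left
    (Complex.ofReal_ne_zero.2 (Strichartz.c_pos n k).ne')
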